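/- Let $d\ge 1$ and let $f:[0,1]^d\to\mathbb R$ be (real-)analytic in an open set containing $[0,1]^d$. Let $\omega:[0,1]^d\to[0,\infty)$ be a Riemann integrable weight function that is positive almost everywhere, and put $I[g]=\int_{[0,1]^d} g(x)\,\omega(x)\,dx$. For every integer $N\ge 1$ let $$C_N[g]=\sum_{n=1}^N w_n^{(N)}\, g\big(x_n^{(N)}\big),\qquad x_n^{(N)}\in[0,1]^d,$$ be an $N$-point cubature formula that is positive, i.e. $w_n^{(N)}>0$ for $n=1,\dots,N$, and $\mathbb P_{m}(\mathbb R^d)$-exact with $m=m(N)$, i.e. $C_N[p]=I[p]$ for all $p\in\mathbb P_{m(N)}(\mathbb R^d)$, where $\mathbb P_m(\mathbb R^d)$ is the space of real polynomials in $d$ variables of total degree at most $m$. Let $K=K(N)=\dim \mathbb P_{m(N)}(\mathbb R^d)$ and assume $N=\mathcal O(K^2)$, i.e. there is a constant $A$ with $N\le A\,K(N)^2$ for all sufficiently large $N$. Then there is a constant $c>0$, depending only on $d$, $f$ and $A$, such that $$\big|I[f]-C_N[f]\big| = \mathcal O\!\left(\exp\!\big(-c\,N^{1/(2d)}/\sqrt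 d\,\big)\right)\qquad (N\to\infty).$$ -/

import Mathlib

open MeasureTheory Filter Asymptotics

/-- The hypercube `[0,1]^d`. -/
def unitCube (d : ℕ) : Set (Fin d → ℝ) := Set.Icc 0 1

/-- A function on the hypercube is Riemann integrable iff it is bounded and continuous
almost everywhere (Lebesgue's criterion). -/
structure RiemannIntegrableOnCube {d : ℕ} (ω : (Fin d → ℝ) → ℝ) : Prop where
  bounded : ∃ B : ℝ, ∀ x ∈ unitCube d, |ω x| ≤ B
  continuous_ae :
    ∀ᵐ x ∂(volume.restrict (unitCube d)), ContinuousWithinAt ω (unitCube d) x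

/-- A weight function on `[0,1]^d`: nonnegative, Riemann integrable and positive almost
everywhere. -/
structure IsWeightFunction {d : ℕ} (ω : (Fin d → ℝ) → ℝ) : Prop where
  nonneg : ∀ x ∈ unitCube d, 0 ≤ ω x
  pos_ae : ∀ᵐ x ∂(volume.restrict (unitCube d)), 0 < ω x
  riemannIntegrable : RiemannIntegrableOnCube ω

/-- The weighted integral `I[f] = ∫_{[0,1]^d} f(x) ω(x) dx`. -/
noncomputable def weightedIntegral {d : ℕ} (ω f : (Fin d → ℝ) → ℝ) : ℝ :=
  ∫ x in unitCube d, f x * ω x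

/-- The space `P_m(ℝ^d)` of real polynomials in `d` variables of total degree at most `m`. -/
noncomputable abbrev polySpace (d m : ℕ) : Submodule ℝ (MvPolynomial (Fin d) ℝ) :=
  MvPolynomial.restrictTotalDegree (Fin d) ℝ m

/-- An `N`-point cubature formula on `[0,1]^d`: `N` data points in the hypercube together with
`N` real cubature weights. -/
structure CubatureFormula (d N : ℕ) where
  point : Fin N → (Fin d → ℝ)
  weight : Fin N → ℝ
  point_mem : ∀ n, point n ∈ unitCube d

namespace CubatureFormula

/-- The value `C_N[f] = ∑ w_n f(x_n)`. -/
noncomputable def apply {d N : ℕ} (C : CubatureFormula d N) (f : (Fin d → ℝ) → ℝ) : ℝ :=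
  ∑ n : Fin N, C.weight n * f (C.point n)

/-- All cubature weights are positive. -/
def IsPositive {d N : ℕ} (C : CubatureFormula d N) : Prop :=
  ∀ n, 0 < C.weight n

/-- `P_m(ℝ^d)`-exactness with respect to the weight function `ω`. -/
def IsExact {d N : ℕ} (C : CubatureFormula d N) (ω : (Fin d → ℝ) → ℝ) (m : ℕ) : Prop :=
  ∀ p ∈ polySpace d m,
    C.apply (fun x => MvPolynomial.eval x p) =
      weightedIntegral ω (fun x => MvPolynomial.eval x p)

end CubatureFormula

/-! ### Iterated differences of real-analytic functions -/

section ForwardDifferences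

variable {E : Type*} [NormedAddCommGroup E] [NormedSpace ℝ E]

/-! Positivity and exactness on constants make the weights sum to the mass of `ω`, so the cubature
error is at most twice that mass times the uniform error of any polynomial of degree at most `m`
(`CubatureFormula.abs_error_le`). That error can be made `O(q ^ m)` with `q < 1`
(`exists_polySpace_approx_of_analytic`), and `K ≤ (m + 1) ^ d` with `N ≤ A * K ^ 2` forces `m + 1`
to be at least a constant times `N ^ (1 / (2 * d))`.

For the geometric rate, `x i = (1 + cos (2π t i)) / 2` turns `f` into an analytic function on the
torus, whose Fourier series becomes a Chebyshev series. Exponential decay of its coefficients is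
proved without leaving the real domain: `k`-th differences kill Taylor polynomials of degree below
`k`, hence are at most `2 ^ k * C * a ^ k` over a fixed span, while a half-period difference
multiplies the coefficient by `(-2) ^ k`. The powers of 2 cancel, and `k` can be taken proportional
to the frequency. -/

theorem fwdDiff_iter_multilinear_diag_eq_zero {i k : ℕ} (hik : i < k) (p : E [×i]→L[ℝ] ℝ)
    (v y : E) : (fwdDiff v)^[k] (fun x => p fun _ => x) y = 0 := by
  classical
  -- Along a line in direction `v` the form is a polynomial in `t` of degree at most `i < k`.
  have hexp : ∀ t : ℝ, (p fun _ => y + t • v) =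
      (∑ s : Finset (Fin i), p (s.piecewise (fun _ => v) fun _ => y) •
        fun t : ℝ => t ^ s.card) t := by
    intro t
    have h := p.map_add_univ (fun _ => t • v) (fun _ => y)
    rw [show ((fun _ => t • v) + fun _ => y : Fin i → E) = fun _ => y + t • v from by
      ext j; simp [add_comm]] at h
    rw [h, Finset.sum_apply]
    refine Finset.sum_congr rfl fun s _ => ?_
    have h2 := p.map_piecewise_smul (fun _ => t) (s.piecewise (fun _ => v) fun _ => y) s
    rw [Finset.prod_const] at h2
    rw [Pi.smul_apply, smul_eq_mul, mul_comm, ← smul_eq_mul, ← h2]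
    congr 1
    ext j
    by_cases hj : j ∈ s <;> simp [hj]
  have hshift : (fwdDiff v)^[k] (fun x => p fun _ => x) y =
      (fwdDiff (1 : ℝ))^[k] (fun t : ℝ => p fun _ => y + t • v) 0 := by
    simp only [fwdDiff_iter_eq_sum_shift, zero_add, nsmul_eq_mul, mul_one, Nat.cast_smul_eq_nsmul]
  rw [hshift, funext hexp, fwdDiff_iter_finsetSum, Finset.sum_apply]
  refine Finset.sum_eq_zero fun s _ => ?_
  rw [fwdDiff_iter_const_smul, fwdDiff_iter_pow_eq_zero_of_lt, smul_zero, Pi.zero_apply]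
  exact (s.card_le_univ.trans_eq (Fintype.card_fin i)).trans_lt hik

theorem fwdDiff_iter_partialSum_eq_zero (p : FormalMultilinearSeries ℝ E ℝ) (k : ℕ) (v y : E) :
    (fwdDiff v)^[k] (p.partialSum k) y = 0 := by
  have h : p.partialSum k = ∑ i ∈ Finset.range k, fun x => p i fun _ => x := by
    ext x; simp [FormalMultilinearSeries.partialSum]
  rw [h, fwdDiff_iter_finsetSum, Finset.sum_apply]
  exact Finset.sum_eq_zero fun i hi =>
    fwdDiff_iter_multilinear_diag_eq_zero (Finset.mem_range.mp hi) _ _ _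

/-- The binomial coefficients sum to `2 ^ k`. This factor stays explicit because the half-period
multiplier cancels it exactly. -/
theorem norm_fwdDiff_iter_le {M F : Type*} [AddCommMonoid M] [NormedAddCommGroup F]
    {f : M → F} {h y : M} {k : ℕ} {B : ℝ} (hB : ∀ j ≤ k, ‖f (y + j • h)‖ ≤ B) :
    ‖(fwdDiff h)^[k] f y‖ ≤ 2 ^ k * B := by
  rw [fwdDiff_iter_eq_sum_shift]
  calc _ ≤ ∑ j ∈ Finset.range (k + 1), (k.choose j : ℝ) * B := by
        refine norm_sum_le_of_le _ fun j hj => ?_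
        have hz : ((-1 : ℤ) ^ (k - j) * (k.choose j : ℤ)) • f (y + j • h) =
            (-1 : ℤ) ^ (k - j) • k.choose j • f (y + j • h) := by
          rw [mul_smul, natCast_zsmul]
        rw [hz]
        have hs : ‖(-1 : ℤ) ^ (k - j) • k.choose j • f (y + j • h)‖ =
            ‖k.choose j • f (y + j • h)‖ := by
          rcases neg_one_pow_eq_or ℤ (k - j) with h1 | h1 <;> simp [h1]
        rw [hs]
        refine (norm_nsmul_le).trans ?_
        gcongr
        exact hB j (Nat.lt_succ_iff.mp (Finset.mem_range.mp hj))
    _ = 2 ^ k * B := by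
        rw [← Finset.sum_mul, ← Nat.cast_sum, Nat.sum_range_choose]; simp

/-- Near a point of analyticity, the `k`-th differences over a total span of length at most `r`
are `2 ^ k` times a geometrically small quantity. -/
theorem AnalyticAt.exists_norm_fwdDiff_iter_le {g : E → ℝ} {x₀ : E} (hg : AnalyticAt ℝ g x₀) :
    ∃ r > 0, ∃ C > 0, ∃ a ∈ Set.Ioo (0 : ℝ) 1, ∀ y ∈ Metric.ball x₀ r, ∀ (k : ℕ) (v : E),
      k * ‖v‖ ≤ r → ‖(fwdDiff v)^[k] g y‖ ≤ 2 ^ k * (C * a ^ k) := by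
  obtain ⟨p, R, hp⟩ := hg
  obtain ⟨r', hr', hr'R⟩ := ENNReal.lt_iff_exists_nnreal_btwn.mp hp.r_pos
  obtain ⟨a, ha, C, hC, happ⟩ := hp.uniform_geometric_approx hr'R
  have hr'pos : (0 : ℝ) < r' := by exact_mod_cast hr'
  -- Half of `r'` is for the base point and half for the displacement `j • v`, so all sample points
  -- stay where the Taylor approximation is uniform.
  refine ⟨r' / 2, by positivity, C, hC, a, ha, fun y hy k v hkv => ?_⟩
  have hzero : (fwdDiff v)^[k] (fun x => p.partialSum k (x + -x₀)) y = 0 := by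
    rw [fwdDiff_iter_comp_add, fwdDiff_iter_partialSum_eq_zero]
  have hsub : (fwdDiff v)^[k] g y =
      (fwdDiff v)^[k] (fun x => g x - p.partialSum k (x + -x₀)) y := by
    have h := congrFun (fwdDiff_iter_add v (fun x => g x - p.partialSum k (x + -x₀))
      (fun x => p.partialSum k (x + -x₀)) k) y
    rw [Pi.add_apply, hzero, add_zero] at h
    rw [← h, show (fun x => g x - p.partialSum k (x + -x₀)) + (fun x => p.partialSum k (x + -x₀))
      = g from funext fun x => sub_add_cancel _ _]
  rw [hsub]
  refine norm_fwdDiff_iter_le fun j hj => ?_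
  have hmem : y + j • v - x₀ ∈ Metric.ball (0 : E) r' := by
    rw [mem_ball_zero_iff]
    have h1 : ‖y - x₀‖ < r' / 2 := by simpa [dist_eq_norm] using hy
    have h2 : ‖j • v‖ ≤ r' / 2 := by
      refine (norm_nsmul_le).trans (le_trans ?_ hkv)
      gcongr
    calc ‖y + j • v - x₀‖ = ‖(y - x₀) + j • v‖ := by congr 1; abel
      _ ≤ _ := norm_add_le _ _
      _ < r' := by linarith
  have := happ _ hmem k
  rwa [add_sub_cancel, sub_eq_add_neg _ x₀] at this

/-- The property passes to subsets and to finite unions (smaller `r`, larger `C` and `a`), so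
compactness globalizes the local bound. -/
theorem IsCompact.exists_norm_fwdDiff_iter_le {g : E → ℝ} {K : Set E} (hK : IsCompact K)
    (hg : AnalyticOnNhd ℝ g K) :
    ∃ r > 0, ∃ C > 0, ∃ a ∈ Set.Ioo (0 : ℝ) 1, ∀ y ∈ K, ∀ (k : ℕ) (v : E),
      k * ‖v‖ ≤ r → ‖(fwdDiff v)^[k] g y‖ ≤ 2 ^ k * (C * a ^ k) := by
  refine hK.induction_on (p := fun s => ∃ r > 0, ∃ C > 0, ∃ a ∈ Set.Ioo (0 : ℝ) 1, ∀ y ∈ s,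
    ∀ (k : ℕ) (v : E), k * ‖v‖ ≤ r → ‖(fwdDiff v)^[k] g y‖ ≤ 2 ^ k * (C * a ^ k)) ?_ ?_ ?_ ?_
  · exact ⟨1, one_pos, 1, one_pos, 1 / 2, by norm_num, by simp⟩
  · rintro s t hst ⟨r, hr, C, hC, a, ha, h⟩
    exact ⟨r, hr, C, hC, a, ha, fun y hy => h y (hst hy)⟩
  · rintro s t ⟨r, hr, C, hC, a, ha, h⟩ ⟨r', hr', C', hC', a', ha', h'⟩
    refine ⟨min r r', lt_min hr hr', max C C', lt_max_of_lt_left hC, max a a',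
      ⟨lt_max_of_lt_left ha.1, max_lt ha.2 ha'.2⟩, fun y hy k v hkv => ?_⟩
    have ha0 := ha.1.le
    have ha0' := ha'.1.le
    rcases hy with hy | hy
    · refine (h y hy k v (hkv.trans (min_le_left _ _))).trans ?_
      gcongr <;> exact le_max_left _ _
    · refine (h' y hy k v (hkv.trans (min_le_right _ _))).trans ?_
      gcongr <;> exact le_max_right _ _
  · intro x hx
    obtain ⟨r, hr, C, hC, a, ha, h⟩ := (hg x hx).exists_norm_fwdDiff_iter_le
    exact ⟨Metric.ball x r, mem_nhdsWithin_of_mem_nhds (Metric.ball_mem_nhds x hr),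
      r, hr, C, hC, a, ha, h⟩

end ForwardDifferences

/-! ### Exponential decay of Fourier coefficients on the torus -/

section TorusCoefficients

open UnitAddTorus

noncomputable local instance haarMeasureSpaceUnitAddCircle : MeasureSpace UnitAddCircle :=
  ⟨AddCircle.haarAddCircle⟩

local instance haarUnitAddCircle_isAddHaarMeasure :
    Measure.IsAddHaarMeasure (volume : Measure UnitAddCircle) :=
  inferInstanceAs (Measure.IsAddHaarMeasure AddCircle.haarAddCircle)

local instance haarUnitAddCircle_isProbabilityMeasure :
    IsProbabilityMeasure (volume : Measure UnitAddCircle) :=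
  inferInstanceAs (IsProbabilityMeasure AddCircle.haarAddCircle)

variable {ι : Type*} [Fintype ι]

theorem mFourier_apply_add (n : ι → ℤ) (x y : UnitAddTorus ι) :
    mFourier n (x + y) = mFourier n x * mFourier n y := by
  simp [mFourier, fourier_apply, smul_add, AddCircle.toCircle_add, Finset.prod_mul_distrib]

theorem mFourierCoeff_comp_add (F : UnitAddTorus ι → ℂ) (h : UnitAddTorus ι) (n : ι → ℤ) :
    mFourierCoeff (fun x => F (x + h)) n = mFourier n h * mFourierCoeff F n := by
  unfold mFourierCoeff
  rw [← integral_add_right_eq_self (fun t => mFourier (-n) t • F t) h, ← integral_const_mul]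
  congr 1
  ext t
  have h1 : mFourier n h * mFourier (-n) h = 1 := by
    rw [← mFourier_add, add_neg_cancel, mFourier_zero]; rfl
  rw [mFourier_apply_add, smul_eq_mul, smul_eq_mul]
  linear_combination (-(mFourier (-n) t * F (t + h))) * h1

theorem integrable_mFourier_smul {F : UnitAddTorus ι → ℂ} (hF : Continuous F) (n : ι → ℤ) :
    Integrable fun t => mFourier n t • F t :=
  ((map_continuous (mFourier n)).smul hF).integrable_of_hasCompactSupport
    (HasCompactSupport.of_compactSpace _)

theorem mFourierCoeff_fwdDiff_iter {F : UnitAddTorus ι → ℂ} (hF : Continuous F)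
    (h : UnitAddTorus ι) (n : ι → ℤ) (k : ℕ) :
    mFourierCoeff ((fwdDiff h)^[k] F) n = (mFourier n h - 1) ^ k * mFourierCoeff F n := by
  induction k generalizing F with
  | zero => simp
  | succ k ih =>
    have hs : Continuous fun x => F (x + h) := hF.comp (continuous_id.add continuous_const)
    rw [Function.iterate_succ_apply, ih (F := fwdDiff h F) (hs.sub hF)]
    have : mFourierCoeff (fwdDiff h F) n = (mFourier n h - 1) * mFourierCoeff F n := by
      rw [sub_mul, one_mul, ← mFourierCoeff_comp_add]
      unfold mFourierCoeff fwdDiff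
      rw [← integral_sub (integrable_mFourier_smul hs _) (integrable_mFourier_smul hF _)]
      simp only [smul_sub]
    rw [this, pow_succ]; ring

theorem norm_mFourierCoeff_le {F : UnitAddTorus ι → ℂ} {B : ℝ} (hB : ∀ x, ‖F x‖ ≤ B)
    (n : ι → ℤ) : ‖mFourierCoeff F n‖ ≤ B := by
  unfold mFourierCoeff
  refine (norm_integral_le_of_norm_le_const (C := B) (ae_of_all _ fun x => ?_)).trans_eq (by simp)
  rw [norm_smul]
  have h1 : ‖mFourier (-n) x‖ ≤ 1 := ((mFourier (-n)).norm_coe_le_norm x).trans_eq mFourier_norm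
  calc _ ≤ 1 * ‖F x‖ := by gcongr
    _ ≤ B := by rw [one_mul]; exact hB x

/-- This step gives the multiplier `-1 - 1`, of the largest possible modulus 2. -/
theorem mFourier_single_half_period [DecidableEq ι] {n : ι → ℤ} {i : ι} (hi : n i ≠ 0) :
    mFourier n (fun j => ((Pi.single i (1 / (2 * (n i : ℝ))) : ι → ℝ) j : UnitAddCircle)) = -1 := by
  have hi' : (n i : ℝ) ≠ 0 := by exact_mod_cast hi
  simp only [mFourier, ContinuousMap.coe_mk]
  rw [Finset.prod_eq_single i]
  · rw [Pi.single_eq_same, fourier_coe_apply]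
    rw [← Complex.exp_pi_mul_I]
    congr 1
    have : (n i : ℂ) ≠ 0 := by exact_mod_cast hi
    push_cast
    field_simp
  · intro j _ hj
    simp [hj]
  · simp

/-- Differences of step half a period bound Fourier coefficients. -/
theorem norm_mFourierCoeff_le_of_fwdDiff_iter [DecidableEq ι] {F : UnitAddTorus ι → ℂ}
    (hF : Continuous F) {n : ι → ℤ} {i : ι} (hi : n i ≠ 0) {k : ℕ} {B : ℝ}
    (hB : ∀ x, ‖(fwdDiff (M := UnitAddTorus ι)
      (fun j => ((Pi.single i (1 / (2 * (n i : ℝ))) : ι → ℝ) j : UnitAddCircle)))^[k] F x‖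
        ≤ 2 ^ k * B) :
    ‖mFourierCoeff F n‖ ≤ B := by
  have h := norm_mFourierCoeff_le hB n
  rw [mFourierCoeff_fwdDiff_iter hF, mFourier_single_half_period hi, norm_mul, norm_pow,
    show ‖(-1 - 1 : ℂ)‖ = 2 by norm_num] at h
  exact le_of_mul_le_mul_left h (by positivity)

/-- The Fourier coefficients of a real-analytic function on the torus decay exponentially. -/
theorem exists_norm_mFourierCoeff_le_of_analytic [Nonempty ι] {F : UnitAddTorus ι → ℂ}
    (hF : Continuous F) {g : (ι → ℝ) → ℝ} (hg : AnalyticOnNhd ℝ g Set.univ)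
    (hgF : ∀ x : ι → ℝ, F (fun i => (x i : UnitAddCircle)) = g x) :
    ∃ C > 0, ∃ q ∈ Set.Ioo (0 : ℝ) 1, ∀ n : ι → ℤ,
      ‖mFourierCoeff F n‖ ≤ C * q ^ (∑ i, (n i).natAbs) := by
  classical
  obtain ⟨r, hr, C, hC, a, ha, h⟩ :=
    (isCompact_Icc (a := (0 : ι → ℝ)) (b := 1)).exists_norm_fwdDiff_iter_le
      (hg.mono (Set.subset_univ _))
  have hdiff : ∀ (v : ι → ℝ) (k : ℕ) (x : ι → ℝ),
      (fwdDiff (M := UnitAddTorus ι) (fun j => (v j : UnitAddCircle)))^[k] F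
        (fun i => (x i : UnitAddCircle)) = (((fwdDiff v)^[k] g x : ℝ) : ℂ) := by
    intro v k x
    rw [fwdDiff_iter_eq_sum_shift, fwdDiff_iter_eq_sum_shift]
    push_cast
    refine Finset.sum_congr rfl fun j _ => ?_
    rw [show ((fun i => (x i : UnitAddCircle)) + j • fun i => (v i : UnitAddCircle) :
      UnitAddTorus ι) = fun i => (((x + j • v) i : ℝ) : UnitAddCircle) from by
        ext i; simp, hgF]
  have hlift : ∀ y : UnitAddTorus ι, ∃ x ∈ Set.Icc (0 : ι → ℝ) 1,
      y = fun i => (x i : UnitAddCircle) := by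
    intro y
    refine ⟨fun i => (AddCircle.equivIco 1 0 (y i) : ℝ), ⟨fun i => ?_, fun i => ?_⟩, ?_⟩
    · exact (AddCircle.equivIco 1 0 (y i)).2.1
    · simpa using (AddCircle.equivIco 1 0 (y i)).2.2.le
    · ext i
      exact ((AddCircle.equivIco 1 0).symm_apply_apply (y i)).symm
  -- The `k` steps of length `1 / (2 * |n i|)` span at most `r` exactly when `k ≤ 2 * r * |n i|`.
  have hcoef : ∀ (n : ι → ℤ) (i : ι) (k : ℕ), n i ≠ 0 → (k : ℝ) ≤ 2 * r * (n i).natAbs →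
      ‖mFourierCoeff F n‖ ≤ C * a ^ k := by
    intro n i k hi hk
    refine norm_mFourierCoeff_le_of_fwdDiff_iter hF hi (k := k) fun y => ?_
    obtain ⟨x, hx, rfl⟩ := hlift y
    rw [hdiff, Complex.norm_real]
    refine h x hx k _ ?_
    rw [Pi.norm_single, norm_div, norm_mul, Real.norm_two, norm_one, Real.norm_eq_abs,
      ← Int.cast_abs, Int.abs_eq_natAbs, Int.cast_natCast]
    have : (0 : ℝ) < (n i).natAbs := by exact_mod_cast Int.natAbs_pos.mpr hi
    rw [mul_one_div, div_le_iff₀ (by positivity)]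
    linarith
  have hcard : (0 : ℝ) < Fintype.card ι := by exact_mod_cast Fintype.card_pos
  -- The largest `|n i|` is at least the average, which converts decay in that entry into decay in
  -- the sum of all entries.
  set s : ℝ := 2 * r / Fintype.card ι with hs
  have hspos : 0 < s := by positivity
  obtain ⟨B, hB⟩ : ∃ B, ∀ x, ‖F x‖ ≤ B := by
    obtain ⟨B, hB⟩ := isCompact_univ.exists_bound_of_continuousOn hF.continuousOn
    exact ⟨B, fun x => hB x trivial⟩
  -- Rounding `k` down costs a factor `1 / a`; `B` covers `n = 0`, where no half-period step exists.
  refine ⟨max (C / a) B, lt_max_of_lt_left (div_pos hC ha.1), a ^ s,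
    ⟨Real.rpow_pos_of_pos ha.1 _, Real.rpow_lt_one ha.1.le ha.2 hspos⟩, fun n => ?_⟩
  obtain ⟨i, -, hmax⟩ := Finset.exists_max_image Finset.univ (fun i => (n i).natAbs)
    Finset.univ_nonempty
  have hq0 : 0 ≤ (a ^ s) ^ (∑ i, (n i).natAbs) := pow_nonneg (Real.rpow_nonneg ha.1.le _) _
  by_cases hi : n i = 0
  · have hz : ∑ i, (n i).natAbs = 0 := Finset.sum_eq_zero fun j hj => by
      have := hmax j hj
      simpa [hi] using this
    rw [hz, pow_zero, mul_one]
    exact (norm_mFourierCoeff_le hB n).trans (le_max_right _ _)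
  · have hk := hcoef n i ⌊2 * r * (n i).natAbs⌋₊ hi (Nat.floor_le (by positivity))
    refine hk.trans (le_trans ?_ (mul_le_mul_of_nonneg_right (le_max_left _ _) hq0))
    rw [div_mul_eq_mul_div, mul_div_assoc]
    gcongr
    rw [le_div_iff₀ ha.1, ← pow_succ, ← Real.rpow_natCast, ← Real.rpow_natCast,
      ← Real.rpow_mul ha.1.le]
    refine Real.rpow_le_rpow_of_exponent_ge ha.1 ha.2.le ?_
    have hsum : ((∑ i, (n i).natAbs : ℕ) : ℝ) ≤ Fintype.card ι * (n i).natAbs := by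
      have := Finset.sum_le_card_nsmul Finset.univ (fun i => (n i).natAbs) _ hmax
      rw [smul_eq_mul, Finset.card_univ] at this
      exact_mod_cast this
    calc s * ((∑ i, (n i).natAbs : ℕ) : ℝ) ≤ s * (Fintype.card ι * (n i).natAbs) := by gcongr
      _ = 2 * r * (n i).natAbs := by rw [hs]; field_simp
      _ ≤ _ := by push_cast; exact (Nat.lt_floor_add_one _).le

end TorusCoefficients

/-! ### Chebyshev series and polynomial approximation on the cube -/

section PolynomialApproximation

open UnitAddTorus

theorem summable_pow_sum_natAbs {q : ℝ} (hq0 : 0 ≤ q) (hq1 : q < 1) (d : ℕ) :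
    Summable fun n : Fin d → ℤ => q ^ (∑ i, (n i).natAbs) := by
  induction d with
  | zero => exact Summable.of_finite
  | succ d ih =>
    rw [← (Fin.consEquiv fun _ => ℤ).summable_iff]
    have h1 : Summable fun n : ℤ => q ^ n.natAbs := by
      refine Summable.of_nat_of_neg ?_ ?_ <;>
        simpa using summable_geometric_of_lt_one hq0 hq1
    refine (h1.mul_of_nonneg ih (fun n => by positivity) (fun n => by positivity)).congr
      fun p => ?_
    simp [Fin.consEquiv, Fin.sum_univ_succ, pow_add]

/-- Averaging a monomial over all sign changes of the variables gives a product of cosines. -/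
theorem sum_signs_mFourier {d : ℕ} (n : Fin d → ℤ) (t : Fin d → ℝ) :
    ∑ ε ∈ Fintype.piFinset fun _ : Fin d => ({1, -1} : Finset ℝ),
      mFourier n (fun i => ((ε i * t i : ℝ) : UnitAddCircle)) =
      ∏ i, ((2 * Real.cos (n i * (2 * Real.pi * t i)) : ℝ) : ℂ) := by
  have h := Finset.prod_univ_sum (fun _ : Fin d => ({1, -1} : Finset ℝ))
    (fun i e => fourier (n i) ((e * t i : ℝ) : UnitAddCircle))
  simp only [mFourier, ContinuousMap.coe_mk]
  rw [← h]
  refine Finset.prod_congr rfl fun i _ => ?_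
  rw [Finset.sum_pair (by norm_num), fourier_coe_apply, fourier_coe_apply]
  push_cast
  rw [Complex.two_cos]
  congr 2 <;> ring

/-- The cosine parametrization of the hypercube by the torus. -/
noncomputable def cubeParam {d : ℕ} (x : UnitAddTorus (Fin d)) : Fin d → ℝ :=
  fun i => (1 + (fourier 1 (x i)).re) / 2

theorem cubeParam_coe {d : ℕ} (t : Fin d → ℝ) :
    cubeParam (fun i => (t i : UnitAddCircle)) =
      fun i => (1 + Real.cos (2 * Real.pi * t i)) / 2 := by
  ext i
  rw [cubeParam, fourier_coe_apply]
  have : (2 * Real.pi * Complex.I * (1 : ℤ) * t i / (1 : ℝ) : ℂ) =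
      ((2 * Real.pi * t i : ℝ) : ℂ) * Complex.I := by push_cast; ring
  rw [this, Complex.exp_ofReal_mul_I_re]

theorem cubeParam_mem {d : ℕ} (x : UnitAddTorus (Fin d)) : cubeParam x ∈ unitCube d := by
  have h : ∀ i, |(fourier 1 (x i)).re| ≤ 1 := fun i =>
    (Complex.abs_re_le_norm _).trans_eq (by rw [fourier_apply]; exact Circle.norm_coe _)
  refine ⟨fun i => ?_, fun i => ?_⟩ <;> have := abs_le.mp (h i) <;>
    simp only [cubeParam, Pi.zero_apply, Pi.one_apply] <;> linarith

theorem continuous_cubeParam {d : ℕ} : Continuous (cubeParam (d := d)) := by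
  unfold cubeParam
  refine continuous_pi fun i => ?_
  have : Continuous fun x : UnitAddTorus (Fin d) => (fourier 1 (x i) : ℂ) :=
    (map_continuous (fourier 1)).comp (continuous_apply i)
  exact (continuous_const.add (Complex.continuous_re.comp this)).div_const 2

/-- The multivariate Chebyshev polynomial `∏ T_{n_i}(2 x_i - 1)` of the unit cube. -/
noncomputable def cubeChebyshev {d : ℕ} (n : Fin d → ℤ) : MvPolynomial (Fin d) ℝ :=
  ∏ i, Polynomial.aeval (MvPolynomial.X i : MvPolynomial (Fin d) ℝ)
    ((Polynomial.Chebyshev.T ℝ (n i)).comp (2 * Polynomial.X - 1))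

theorem eval_cubeChebyshev {d : ℕ} (n : Fin d → ℤ) (x : Fin d → ℝ) :
    MvPolynomial.eval x (cubeChebyshev n) =
      ∏ i, (Polynomial.Chebyshev.T ℝ (n i)).eval (2 * x i - 1) := by
  rw [cubeChebyshev, map_prod]
  refine Finset.prod_congr rfl fun i _ => ?_
  rw [← MvPolynomial.coe_aeval_eq_eval, RingHom.coe_coe, ← Polynomial.aeval_algHom_apply,
    MvPolynomial.aeval_X]
  simp [Polynomial.aeval_def]

theorem MvPolynomial.totalDegree_aeval_X_le {σ R : Type*} [CommSemiring R] [Nontrivial R]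
    (P : Polynomial R)
    (i : σ) : (Polynomial.aeval (MvPolynomial.X i : MvPolynomial σ R) P).totalDegree
      ≤ P.natDegree := by
  rw [Polynomial.aeval_eq_sum_range]
  refine MvPolynomial.totalDegree_finsetSum_le fun j hj => ?_
  refine (MvPolynomial.totalDegree_smul_le _ _).trans ((MvPolynomial.totalDegree_pow _ _).trans ?_)
  rw [MvPolynomial.totalDegree_X, mul_one]
  exact Nat.lt_succ_iff.mp (Finset.mem_range.mp hj)

theorem totalDegree_cubeChebyshev_le {d : ℕ} (n : Fin d → ℤ) :
    (cubeChebyshev n).totalDegree ≤ ∑ i, (n i).natAbs := by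
  refine (MvPolynomial.totalDegree_finsetProd _ _).trans (Finset.sum_le_sum fun i _ => ?_)
  refine (MvPolynomial.totalDegree_aeval_X_le _ i).trans
    ((Polynomial.natDegree_comp_le).trans ?_)
  rw [Polynomial.Chebyshev.natDegree_T]
  refine (Nat.mul_le_mul_left _ (?_ : _ ≤ 1)).trans_eq (mul_one _)
  compute_degree

theorem abs_eval_cubeChebyshev_le {d : ℕ} (n : Fin d → ℤ) {x : Fin d → ℝ} (hx : x ∈ unitCube d) :
    |MvPolynomial.eval x (cubeChebyshev n)| ≤ 1 := by
  rw [eval_cubeChebyshev, Finset.abs_prod]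
  refine Finset.prod_le_one (fun i _ => abs_nonneg _) fun i _ => ?_
  have h0 := hx.1 i
  have h1 := hx.2 i
  simp only [Pi.zero_apply, Pi.one_apply] at h0 h1
  rw [← Real.cos_arccos (x := 2 * x i - 1) (by linarith) (by linarith),
    Polynomial.Chebyshev.T_real_cos]
  exact Real.abs_cos_le_one _

/-- A function on the cube that is analytic on a neighbourhood is the sum of a Chebyshev series
with exponentially decaying coefficients. -/
theorem exists_hasSum_cubeChebyshev {d : ℕ} (hd : 1 ≤ d) {f : (Fin d → ℝ) → ℝ}
    (hf : AnalyticOnNhd ℝ f (unitCube d)) :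
    ∃ a : (Fin d → ℤ) → ℝ, ∃ C > 0, ∃ q ∈ Set.Ioo (0 : ℝ) 1,
      (∀ n, |a n| ≤ C * q ^ (∑ i, (n i).natAbs)) ∧
      ∀ x ∈ unitCube d, HasSum (fun n => a n * MvPolynomial.eval x (cubeChebyshev n)) (f x) := by
  have : Nonempty (Fin d) := ⟨⟨0, hd⟩⟩
  let F : C(UnitAddTorus (Fin d), ℂ) :=
    ⟨fun x => (f (cubeParam x) : ℂ), Complex.continuous_ofReal.comp
      (hf.continuousOn.comp_continuous continuous_cubeParam cubeParam_mem)⟩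
  let g : (Fin d → ℝ) → ℝ := fun t => f fun i => (1 + Real.cos (2 * Real.pi * t i)) / 2
  have hFg : ∀ t : Fin d → ℝ, F (fun i => (t i : UnitAddCircle)) = g t := fun t => by
    change ((f (cubeParam _) : ℝ) : ℂ) = _
    rw [cubeParam_coe]
  have hg : AnalyticOnNhd ℝ g Set.univ := by
    intro t _
    have hmem : (fun i => (1 + Real.cos (2 * Real.pi * t i)) / 2) ∈ unitCube d := by
      rw [← cubeParam_coe]; exact cubeParam_mem _
    refine (hf _ hmem).comp (f := fun t : Fin d → ℝ =>
      fun i => (1 + Real.cos (2 * Real.pi * t i)) / 2) ?_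
    rw [analyticAt_pi_iff]
    intro i
    have hi : AnalyticAt ℝ (fun t : Fin d → ℝ => t i) t :=
      (ContinuousLinearMap.proj (R := ℝ) (φ := fun _ : Fin d => ℝ) i).analyticAt t
    have hc : AnalyticAt ℝ (fun t : Fin d → ℝ => Real.cos (2 * Real.pi * t i)) t :=
      Real.analyticAt_cos.comp (f := fun t : Fin d → ℝ => 2 * Real.pi * t i)
        (analyticAt_const.mul hi)
    exact (analyticAt_const.add hc).div analyticAt_const two_ne_zero
  obtain ⟨C, hC, q, hq, hcoef⟩ := exists_norm_mFourierCoeff_le_of_analytic F.continuous hg hFg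
  refine ⟨fun n => (mFourierCoeff F n).re, C, hC, q, hq,
    fun n => (Complex.abs_re_le_norm _).trans (hcoef n), fun x hx => ?_⟩
  have hsumm : Summable (mFourierCoeff F) :=
    Summable.of_norm_bounded ((summable_pow_sum_natAbs hq.1.le hq.2 d).mul_left C) hcoef
  let t : Fin d → ℝ := fun i => Real.arccos (2 * x i - 1) / (2 * Real.pi)
  have ht : ∀ i, Real.cos (2 * Real.pi * t i) = 2 * x i - 1 := fun i => by
    have h0 := hx.1 i
    have h1 := hx.2 i
    simp only [Pi.zero_apply, Pi.one_apply] at h0 h1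
    simp only [t]
    rw [mul_div_cancel₀ _ (by positivity), Real.cos_arccos (by linarith) (by linarith)]
  -- Cosine is even, so all `2 ^ d` sign choices parametrize the same `x`; averaging their
  -- expansions turns exponentials into products of cosines, that is, Chebyshev polynomials at `x`.
  have hval : ∀ ε ∈ Fintype.piFinset (fun _ : Fin d => ({1, -1} : Finset ℝ)),
      HasSum (fun n => mFourierCoeff F n * mFourier n
        (fun i => ((ε i * t i : ℝ) : UnitAddCircle))) (f x : ℂ) := by
    intro ε hε
    have h := hasSum_mFourier_series_apply_of_summable hsumm
      (fun i => ((ε i * t i : ℝ) : UnitAddCircle))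
    rw [hFg (fun i => ε i * t i)] at h
    have : g (fun i => ε i * t i) = f x := by
      simp only [g]
      congr 1
      ext i
      have hεi : ε i = 1 ∨ ε i = -1 := by
        simpa using Fintype.mem_piFinset.mp hε i
      have : Real.cos (2 * Real.pi * (ε i * t i)) = Real.cos (2 * Real.pi * t i) := by
        rcases hεi with h | h <;> simp [h]
      rw [this, ht]; ring
    rwa [this] at h
  have htot := hasSum_sum hval
  simp_rw [← Finset.mul_sum, sum_signs_mFourier] at htot
  have hre := Complex.hasSum_re htot
  have hcard : (Fintype.piFinset (fun _ : Fin d => ({1, -1} : Finset ℝ))).card = 2 ^ d := by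
    rw [Fintype.card_piFinset, Finset.prod_const, Finset.card_pair (by norm_num)]; simp
  rw [Finset.sum_const, hcard, nsmul_eq_mul] at hre
  have h2 := hre.mul_left (((2 : ℝ) ^ d)⁻¹)
  have hterm : ∀ n : Fin d → ℤ, (2 ^ d)⁻¹ * (mFourierCoeff F n *
      ∏ i, ((2 * Real.cos (n i * (2 * Real.pi * t i)) : ℝ) : ℂ)).re =
      (mFourierCoeff F n).re * MvPolynomial.eval x (cubeChebyshev n) := fun n => by
    rw [← Complex.ofReal_prod, Complex.re_mul_ofReal, Finset.prod_mul_distrib, eval_cubeChebyshev]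
    simp_rw [← ht, Polynomial.Chebyshev.T_real_cos]
    rw [Finset.prod_const, Finset.card_univ, Fintype.card_fin,
      mul_left_comm, inv_mul_cancel_left₀ (by positivity)]
  have hlim : (2 ^ d)⁻¹ * (((2 ^ d : ℕ) : ℂ) * (f x : ℂ)).re = f x := by
    rw [← Complex.ofReal_natCast, ← Complex.ofReal_mul, Complex.ofReal_re]
    push_cast
    field_simp
  rwa [hlim, funext hterm] at h2

/-- Polynomial approximation at a geometric rate in the total degree. -/
theorem exists_polySpace_approx_of_analytic {d : ℕ} (hd : 1 ≤ d) {f : (Fin d → ℝ) → ℝ}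
    (hf : AnalyticOnNhd ℝ f (unitCube d)) :
    ∃ C > 0, ∃ q ∈ Set.Ioo (0 : ℝ) 1, ∀ m : ℕ, ∃ p ∈ polySpace d m,
      ∀ x ∈ unitCube d, |f x - MvPolynomial.eval x p| ≤ C * q ^ m := by
  obtain ⟨a, C, hC, q, hq, ha, hsum⟩ := exists_hasSum_cubeChebyshev hd hf
  -- In the tail, `q` is split as `√q * √q`: one factor supplies the rate `√q ^ m`, the other keeps
  -- the sum finite.
  have hs0 : 0 < √q := Real.sqrt_pos.mpr hq.1
  have hs1 : √q < 1 := (Real.sqrt_lt' one_pos).mpr (by simpa using hq.2)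
  have hS := summable_pow_sum_natAbs hs0.le hs1 d
  set Z := ∑' n : Fin d → ℤ, √q ^ (∑ i, (n i).natAbs) with hZ
  have hZpos : 0 ≤ Z := tsum_nonneg fun n => by positivity
  refine ⟨C * (Z + 1), by positivity, √q, ⟨hs0, hs1⟩, fun m => ?_⟩
  -- The box only serves to make the index set finite; the degree condition already implies it.
  let S : Finset (Fin d → ℤ) := (Fintype.piFinset fun _ => Finset.Icc (-(m : ℤ)) m).filter
    fun n => ∑ i, (n i).natAbs ≤ m
  have hmemS : ∀ n, n ∉ S → m ≤ ∑ i, (n i).natAbs := by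
    intro n hn
    by_contra! hlt
    refine hn (Finset.mem_filter.mpr ⟨Fintype.mem_piFinset.mpr fun i => ?_, hlt.le⟩)
    have : (n i).natAbs ≤ ∑ i, (n i).natAbs :=
      Finset.single_le_sum (f := fun i => (n i).natAbs) (fun _ _ => Nat.zero_le _)
        (Finset.mem_univ i)
    rw [Finset.mem_Icc]
    omega
  refine ⟨∑ n ∈ S, a n • cubeChebyshev n, Submodule.sum_mem _ fun n hn =>
    Submodule.smul_mem _ _ ?_, fun x hx => ?_⟩
  · rw [MvPolynomial.mem_restrictTotalDegree]
    exact (totalDegree_cubeChebyshev_le n).trans (Finset.mem_filter.mp hn).2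
  · have heval : MvPolynomial.eval x (∑ n ∈ S, a n • cubeChebyshev n) =
        ∑ n ∈ S, a n * MvPolynomial.eval x (cubeChebyshev n) := by
      simp [MvPolynomial.smul_eval]
    have hx' := hsum x hx
    have htail := hx'.summable.sum_add_tsum_compl (s := S)
    rw [hx'.tsum_eq] at htail
    have hbound : ∀ n : ↥((S : Set (Fin d → ℤ))ᶜ),
        ‖a n * MvPolynomial.eval x (cubeChebyshev (n : Fin d → ℤ))‖ ≤
          C * √q ^ m * √q ^ (∑ i, ((n : Fin d → ℤ) i).natAbs) := by
      rintro ⟨n, hn⟩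
      rw [norm_mul, Real.norm_eq_abs, Real.norm_eq_abs]
      calc |a n| * |MvPolynomial.eval x (cubeChebyshev n)|
          ≤ (C * q ^ (∑ i, (n i).natAbs)) * 1 := by
            exact mul_le_mul (ha n) (abs_eval_cubeChebyshev_le n hx) (abs_nonneg _)
              ((abs_nonneg _).trans (ha n))
        _ = C * (√q ^ (∑ i, (n i).natAbs) * √q ^ (∑ i, (n i).natAbs)) := by
            rw [mul_one, ← mul_pow, Real.mul_self_sqrt hq.1.le]
        _ ≤ C * (√q ^ m * √q ^ (∑ i, (n i).natAbs)) := by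
            gcongr ?_ * (?_ * _)
            exact pow_le_pow_of_le_one hs0.le hs1.le (hmemS n (by simpa using hn))
        _ = _ := by ring
    have hsub := (hS.mul_left (C * √q ^ m)).subtype ((S : Set (Fin d → ℤ))ᶜ)
    rw [heval, ← htail, add_sub_cancel_left, ← Real.norm_eq_abs]
    refine (tsum_of_norm_bounded hsub.hasSum hbound).trans ?_
    calc _ ≤ ∑' n : Fin d → ℤ, C * √q ^ m * √q ^ (∑ i, (n i).natAbs) :=
          Summable.tsum_subtype_le _ _ (fun n => by positivity) (hS.mul_left (C * √q ^ m))
      _ = C * √q ^ m * Z := tsum_mul_left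
      _ ≤ C * (Z + 1) * √q ^ m := by
          have : 0 ≤ C * √q ^ m := by positivity
          nlinarith

end PolynomialApproximation

/-! ### Dimension count, measurability of the weight, and the cubature error -/

section Cubature

/-- Every exponent of a monomial is at most `m`. This crude count suffices, since only the order `m
^ d` matters. -/
theorem finrank_polySpace_le (d m : ℕ) : Module.finrank ℝ (polySpace d m) ≤ (m + 1) ^ d := by
  have hb := Module.finrank_eq_nat_card_basis
    (MvPolynomial.basisRestrictSupport ℝ {s : Fin d →₀ ℕ | s.sum (fun _ e => e) ≤ m})
  have hle : ∀ s : Fin d →₀ ℕ, s.sum (fun _ e => e) ≤ m → ∀ i, s i < m + 1 := by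
    intro s hs i
    rw [Finsupp.sum_fintype _ _ fun _ => rfl] at hs
    exact Nat.lt_succ_of_le ((Finset.single_le_sum (f := fun i => s i)
      (fun _ _ => Nat.zero_le _) (Finset.mem_univ i)).trans hs)
  have hinj : Function.Injective
      (fun (s : {s : Fin d →₀ ℕ | s.sum (fun _ e => e) ≤ m}) (i : Fin d) =>
        (⟨s.1 i, hle s.1 s.2 i⟩ : Fin (m + 1))) := by
    intro s t hst
    ext i
    simpa using congrFun hst i
  have hcard := Nat.card_le_card_of_injective _ hinj
  refine hb.le.trans (hcard.trans_eq ?_)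
  simp

theorem isCompact_unitCube (d : ℕ) : IsCompact (unitCube d) := isCompact_Icc

theorem measurableSet_unitCube (d : ℕ) : MeasurableSet (unitCube d) := measurableSet_Icc

theorem tendsto_floor_mul_div (t : ℝ) :
    Tendsto (fun k : ℕ => (⌊((k : ℝ) + 1) * t⌋ : ℝ) / ((k : ℝ) + 1)) atTop (nhds t) := by
  have h1 := (tendsto_const_nhds (x := t)).sub
    (tendsto_one_div_add_atTop_nhds_zero_nat (𝕜 := ℝ))
  rw [sub_zero] at h1
  refine tendsto_of_tendsto_of_tendsto_of_le_of_le h1 tendsto_const_nhds (fun k => ?_) fun k => ?_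
  · have hk : (0 : ℝ) < (k : ℝ) + 1 := by positivity
    rw [le_div_iff₀ hk, sub_mul, one_div_mul_cancel hk.ne']
    have := Int.lt_floor_add_one (((k : ℝ) + 1) * t)
    linarith
  · have hk : (0 : ℝ) < (k : ℝ) + 1 := by positivity
    rw [div_le_iff₀ hk]
    have := Int.floor_le (((k : ℝ) + 1) * t)
    linarith

/-- A function that is continuous almost everywhere on the cube is almost everywhere strongly
measurable there, being the almost everywhere limit of step functions. -/
theorem aestronglyMeasurable_of_ae_continuousWithinAt {d : ℕ} {ω : (Fin d → ℝ) → ℝ}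
    (hω : ∀ᵐ x ∂(volume.restrict (unitCube d)), ContinuousWithinAt ω (unitCube d) x) :
    AEStronglyMeasurable ω (volume.restrict (unitCube d)) := by
  -- Rounding down to a grid takes countably many values, so `ω ∘ φ k` is measurable whatever `ω`
  -- is; it also keeps points in the cube, where continuity within the cube applies.
  let φ : ℕ → (Fin d → ℝ) → (Fin d → ℝ) :=
    fun k x i => (⌊((k : ℝ) + 1) * x i⌋ : ℝ) / ((k : ℝ) + 1)
  have hmeas : ∀ k, Measurable fun x => ω (φ k x) := fun k => by
    have h1 : Measurable fun (x : Fin d → ℝ) (i : Fin d) => ⌊((k : ℝ) + 1) * x i⌋ :=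
      measurable_pi_lambda _ fun i =>
        Int.measurable_floor.comp ((measurable_pi_apply i).const_mul _)
    exact (measurable_of_countable fun z : Fin d → ℤ =>
      ω fun i => (z i : ℝ) / ((k : ℝ) + 1)).comp h1
  refine aestronglyMeasurable_of_tendsto_ae (u := atTop) (f := fun k x => ω (φ k x))
    (fun k => (hmeas k).aestronglyMeasurable) ?_
  filter_upwards [hω, ae_restrict_mem (measurableSet_unitCube d)] with x hx hxc
  refine hx.tendsto.comp (tendsto_nhdsWithin_iff.mpr
    ⟨tendsto_pi_nhds.mpr fun i => tendsto_floor_mul_div (x i), Eventually.of_forall fun k => ?_⟩)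
  have hk : (0 : ℝ) < (k : ℝ) + 1 := by positivity
  refine ⟨fun i => ?_, fun i => ?_⟩
  · have h0 : 0 ≤ x i := hxc.1 i
    exact div_nonneg (Int.cast_nonneg (Int.floor_nonneg.mpr (mul_nonneg hk.le h0))) hk.le
  · have h1 : x i ≤ 1 := hxc.2 i
    refine (div_le_one hk).mpr ((Int.floor_le _).trans ?_)
    nlinarith

theorem RiemannIntegrableOnCube.integrableOn_mul {d : ℕ} {ω g : (Fin d → ℝ) → ℝ}
    (hω : RiemannIntegrableOnCube ω) (hg : ContinuousOn g (unitCube d)) :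
    IntegrableOn (fun x => g x * ω x) (unitCube d) := by
  obtain ⟨B, hB⟩ := hω.bounded
  exact (hg.integrableOn_compact (isCompact_unitCube d)).mul_bdd
    (aestronglyMeasurable_of_ae_continuousWithinAt hω.continuous_ae)
    ((ae_restrict_mem (measurableSet_unitCube d)).mono fun x hx => hB x hx)

/-- A positive exact cubature formula has an error at most twice the error of polynomial
approximation, in units of the total mass of the weight. -/
theorem CubatureFormula.abs_error_le {d N m : ℕ} {ω f : (Fin d → ℝ) → ℝ}
    (hω : IsWeightFunction ω) (hf : ContinuousOn f (unitCube d)) {C : CubatureFormula d N}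
    (hpos : C.IsPositive) (hex : C.IsExact ω m) {p : MvPolynomial (Fin d) ℝ}
    (hp : p ∈ polySpace d m) {ε : ℝ}
    (hε : ∀ x ∈ unitCube d, |f x - MvPolynomial.eval x p| ≤ ε) :
    |weightedIntegral ω f - C.apply f| ≤ 2 * (∫ x in unitCube d, ω x) * ε := by
  have hpc : ContinuousOn (fun x => MvPolynomial.eval x p) (unitCube d) :=
    (MvPolynomial.continuous_eval p).continuousOn
  -- Exactness on the constant 1; by positivity this is also the sum of the `|w_n|`.
  have hmass : ∑ n, C.weight n = ∫ x in unitCube d, ω x := by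
    have h := hex 1 (by rw [MvPolynomial.mem_restrictTotalDegree]; simp)
    simpa [CubatureFormula.apply, weightedIntegral] using h
  have hωi : IntegrableOn ω (unitCube d) := by
    simpa using hω.riemannIntegrable.integrableOn_mul (g := fun _ => 1) continuousOn_const
  have hI : |weightedIntegral ω f - weightedIntegral ω (fun x => MvPolynomial.eval x p)| ≤
      (∫ x in unitCube d, ω x) * ε := by
    unfold weightedIntegral
    rw [← integral_sub (hω.riemannIntegrable.integrableOn_mul hf)
      (hω.riemannIntegrable.integrableOn_mul hpc), ← integral_mul_const,
      ← Real.norm_eq_abs]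
    refine norm_integral_le_of_norm_le (hωi.mul_const ε) ?_
    filter_upwards [ae_restrict_mem (measurableSet_unitCube d)] with x hx
    rw [← sub_mul, norm_mul, Real.norm_eq_abs, Real.norm_of_nonneg (hω.nonneg x hx), mul_comm]
    exact mul_le_mul_of_nonneg_left (hε x hx) (hω.nonneg x hx)
  have hC : |C.apply (fun x => MvPolynomial.eval x p) - C.apply f| ≤
      (∫ x in unitCube d, ω x) * ε := by
    unfold CubatureFormula.apply
    rw [← Finset.sum_sub_distrib, ← hmass, Finset.sum_mul]
    refine (Finset.abs_sum_le_sum_abs _ _).trans (Finset.sum_le_sum fun n _ => ?_)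
    rw [← mul_sub, abs_mul, abs_of_pos (hpos n), abs_sub_comm]
    exact mul_le_mul_of_nonneg_left (hε _ (C.point_mem n)) (hpos n).le
  rw [hex p hp] at hC
  calc _ ≤ _ := abs_sub_le _ (weightedIntegral ω fun x => MvPolynomial.eval x p) _
    _ ≤ _ := by linarith

/-- Both sides are raised to the power `1 / (2 * d)`; `max A 1` makes the constant positive for any
real `A`. -/
theorem rpow_le_of_le_mul_sq {d m N K : ℕ} (hd : 1 ≤ d) {A : ℝ} (hK : K ≤ (m + 1) ^ d)
    (hN : (N : ℝ) ≤ A * (K : ℝ) ^ 2) :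
    (N : ℝ) ^ (1 / (2 * (d : ℝ))) ≤ (max A 1) ^ (1 / (2 * (d : ℝ))) * (m + 1) := by
  have hd' : (0 : ℝ) < d := by exact_mod_cast hd
  have hA : 0 ≤ max A 1 := le_max_of_le_right zero_le_one
  have hK' : (K : ℝ) ≤ ((m : ℝ) + 1) ^ d := by exact_mod_cast hK
  have h1 : (N : ℝ) ≤ max A 1 * ((m : ℝ) + 1) ^ (2 * (d : ℝ)) := by
    calc (N : ℝ) ≤ A * (K : ℝ) ^ 2 := hN
      _ ≤ max A 1 * (((m : ℝ) + 1) ^ d) ^ 2 := by gcongr; exact le_max_left _ _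
      _ = _ := by
        rw [← pow_mul, ← Real.rpow_natCast]
        congr 2
        push_cast; ring
  calc _ ≤ (max A 1 * ((m : ℝ) + 1) ^ (2 * (d : ℝ))) ^ (1 / (2 * (d : ℝ))) := by gcongr
    _ = _ := by
      rw [Real.mul_rpow hA (by positivity), ← Real.rpow_mul (by positivity),
        mul_one_div_cancel (by positivity), Real.rpow_one]

end Cubature

/-! ### The error bound in terms of `N` -/

theorem mainTheorem5 (d : ℕ) (hd : 1 ≤ d)
    (f : (Fin d → ℝ) → ℝ) (U : Set (Fin d → ℝ)) (hU : IsOpen U) (hUcube : unitCube d ⊆ U)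
    (hf : AnalyticOnNhd ℝ f U) (A : ℝ) :
    ∃ c : ℝ, 0 < c ∧
      ∀ (ω : (Fin d → ℝ) → ℝ), IsWeightFunction ω →
      ∀ (m : ℕ → ℕ) (C : (N : ℕ) → CubatureFormula d N),
        (∀ N, 1 ≤ N → (C N).IsPositive ∧ (C N).IsExact ω (m N)) →
        IsBigOWith A atTop (fun N : ℕ => (N : ℝ))
          (fun N : ℕ => (Module.finrank ℝ (polySpace d (m N)) : ℝ) ^ 2) →
        (fun N : ℕ => weightedIntegral ω f - (C N).apply f) =O[atTop]
          (fun N : ℕ => Real.exp (-c * (N : ℝ) ^ (1 / (2 * (d : ℝ))) / Real.sqrt d)) := by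
  have hf' := hf.mono hUcube
  obtain ⟨B, hB, q, hq, happ⟩ := exists_polySpace_approx_of_analytic hd hf'
  have hd' : (0 : ℝ) < d := by exact_mod_cast hd
  have hsd : 0 < Real.sqrt d := Real.sqrt_pos.mpr hd'
  have hlog : 0 < -Real.log q := neg_pos.mpr (Real.log_neg hq.1 hq.2)
  set β : ℝ := (max A 1) ^ (1 / (2 * (d : ℝ))) with hβ
  have hβ0 : 0 < β := Real.rpow_pos_of_pos (lt_max_of_lt_right one_pos) _
  -- The factor `√d` cancels the one in the exponent. Both `q` and `β` are fixed before `ω`, `m` and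
  -- `C`, so the rate depends only on `d`, `f` and `A`.
  refine ⟨Real.sqrt d * -Real.log q / β, by positivity, fun ω hω m C hC hN => ?_⟩
  have hmass : 0 ≤ ∫ x in unitCube d, ω x :=
    setIntegral_nonneg (measurableSet_unitCube d) hω.nonneg
  -- The factor `exp (-log q) = 1 / q` absorbs the shift from `m` to `m + 1`.
  refine IsBigO.of_bound (2 * (∫ x in unitCube d, ω x) * (B * Real.exp (-Real.log q))) ?_
  filter_upwards [hN.bound, eventually_ge_atTop 1] with N hNN hN1
  obtain ⟨p, hp, hpf⟩ := happ (m N)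
  have herr := CubatureFormula.abs_error_le hω hf'.continuousOn (hC N hN1).1 (hC N hN1).2 hp hpf
  rw [Real.norm_eq_abs, Real.norm_of_nonneg (Real.exp_pos _).le]
  refine herr.trans ?_
  have hK := finrank_polySpace_le d (m N)
  have hNN' : (N : ℝ) ≤ A * (Module.finrank ℝ (polySpace d (m N)) : ℝ) ^ 2 := by
    simpa using hNN
  have hroot := rpow_le_of_le_mul_sq hd hK hNN'
  rw [← hβ] at hroot
  rw [mul_assoc (2 * _), mul_assoc B, ← Real.exp_add]
  gcongr
  rw [← Real.exp_log (pow_pos hq.1 (m N)), Real.log_pow, Real.exp_le_exp]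
  have hroot' : (N : ℝ) ^ (1 / (2 * (d : ℝ))) / β ≤ m N + 1 := by
    rw [div_le_iff₀ hβ0]; linarith
  have heq : -(Real.sqrt d * -Real.log q / β) * (N : ℝ) ^ (1 / (2 * (d : ℝ))) / Real.sqrt d =
      -(-Real.log q * ((N : ℝ) ^ (1 / (2 * (d : ℝ))) / β)) := by
    field_simp
  rw [heq]
  have := mul_le_mul_of_nonneg_left hroot' hlog.le
  linarith
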